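/- Let $d\ge 1$ and $N\ge 2$ be integers, and give $\mathrm{GL}_d(\mathbb{R})^N$ its usual topology. For a real $d\times d$ matrix $A$ with singular values $\sigma_1(A)\ge\cdots\ge\sigma_d(A)$ put \[\varphi^s(A):=\begin{cases}\sigma_1(A)\cdots\sigma_{\lfloor s\rfloor}(A)\,\sigma_{\lceil s\rceil}(A)^{s-\lfloor s\rfloor}&\text{if }0\le s\le d,\\ |\det A|^{s/d}&\text{if }s\ge d,\end{cases}\] and for $(A_1,\ldots,A_N)\in\mathrm{GL}_d(\mathbb{R})^N$ and $s\ge 0$ put \[P(A_1,\ldots,A_N;s):=\lim_{n\to\infty}\frac1n\log\sum_{i_1,\ldots,i_n=1}^N\varphi^s(A_{i_n}\cdots A_{i_1}).\] If the $A_i$ are contracting with respect to some norm on $\mathbb{R}^d$, then $s\mapsto P(A_1,\ldots,A_N;s)$ has a unique zero in $[0,\infty)$, which is called the affinity dimension of $(A_1,\ldots,A_N)$ and denoted by $\dim_{\mathrm{aff}}(A_1,\ldots,A_N)$. Then the set of all $(A_1,\ldots,A_N)\in\mathrm{GL}_d(\mathbb{R})^N$ with the following four properties is an open subset of $\mathrm{GL}_d(\mathbb{R})^N$: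 (i) there exists a norm on $\mathbb{R}^d$ for which the operator norm of $A_i$ is less than $1$ for every $i=1,\ldots,N$; (ii) $0<\dim_{\mathrm{aff}}(A_1,\ldots,A_N)<d$; (iii) the tuple is irreducible: no proper nonzero linear subspace of $\mathbb{R}^d$ is preserved by every $A_i$; (iv) there does not exist an inner product on $\mathbb{R}^d$ with respect to which $A_1,\ldots,A_N$ are all similitudes. -/

import Mathlib

open Filter Topology

noncomputable section

/-- The `k`-th singular value `σ_k(A)` of a real `d × d` matrix, for `1 ≤ k ≤ d`, in decreasing
order: `σ_1(A) ≥ ⋯ ≥ σ_d(A)`. (Mathlib numbers singular values from `0`.) -/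
def matrixSingularValue {d : ℕ} (A : Matrix (Fin d) (Fin d) ℝ) (k : ℕ) : ℝ :=
  (Matrix.toEuclideanLin A).singularValues (k - 1)

/-- The singular value function `φ^s(A)`, for `s ≥ 0`:
`σ_1(A) ⋯ σ_⌊s⌋(A) · σ_⌈s⌉(A) ^ (s - ⌊s⌋)` if `s ≤ d`, and `|det A| ^ (s / d)` if `s ≥ d`. -/
def singularValueFunction {d : ℕ} (s : ℝ) (A : Matrix (Fin d) (Fin d) ℝ) : ℝ :=
  if s ≤ d then
    (∏ k ∈ Finset.Icc 1 ⌊s⌋₊, matrixSingularValue A k) *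
      matrixSingularValue A ⌈s⌉₊ ^ (s - (⌊s⌋₊ : ℝ))
  else |A.det| ^ (s / (d : ℝ))

/-- The product `A_{i_n} ⋯ A_{i_1}` along a word `i = (i_1, …, i_n)`. -/
def wordProduct {d N n : ℕ} (A : Fin N → GL (Fin d) ℝ) (i : Fin n → Fin N) : GL (Fin d) ℝ :=
  (List.ofFn fun k => A (i k)).reverse.prod

/-- The singular value pressure
`P(A_1, …, A_N; s) = lim_{n → ∞} (1 / n) log ∑_{i_1, …, i_n} φ^s(A_{i_n} ⋯ A_{i_1})`. -/
def singularValuePressure {d N : ℕ} (A : Fin N → GL (Fin d) ℝ) (s : ℝ) : ℝ :=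
  limUnder atTop fun n : ℕ =>
    (1 / (n : ℝ)) *
      Real.log (∑ i : Fin n → Fin N,
        singularValueFunction s (wordProduct A i : Matrix (Fin d) (Fin d) ℝ))

/-- The affinity dimension: the zero of `s ↦ P(A_1, …, A_N; s)` on `[0, ∞)`, which exists and is
unique for every tuple that is contracting for some norm. -/
def affinityDimension {d N : ℕ} (A : Fin N → GL (Fin d) ℝ) : ℝ :=
  sInf {s : ℝ | 0 ≤ s ∧ singularValuePressure A s = 0}

/-- There is a norm on `ℝ^d` for which every `A_i` has operator norm `< 1`. -/
def IsContractingTuple {d N : ℕ} (A : Fin N → GL (Fin d) ℝ) : Prop :=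
  ∃ p : Seminorm ℝ (Fin d → ℝ), (∀ x, p x = 0 → x = 0) ∧
    ∀ i, ∃ c : ℝ, c < 1 ∧ ∀ x, p ((A i : Matrix (Fin d) (Fin d) ℝ).mulVec x) ≤ c * p x

/-- No proper nonzero subspace of `ℝ^d` is preserved by every `A_i`. -/
def IsIrreducibleTuple {d N : ℕ} (A : Fin N → GL (Fin d) ℝ) : Prop :=
  ∀ U : Submodule ℝ (Fin d → ℝ),
    (∀ i, ∀ u ∈ U, (A i : Matrix (Fin d) (Fin d) ℝ).mulVec u ∈ U) → U = ⊥ ∨ U = ⊤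

/-- `A` is a similitude for the inner product `c` on `ℝ^d`: it multiplies all lengths by
some `r > 0`. -/
def IsSimilitudeFor {d : ℕ} (c : InnerProductSpace.Core ℝ (Fin d → ℝ))
    (A : Matrix (Fin d) (Fin d) ℝ) : Prop :=
  ∃ r : ℝ, 0 < r ∧ ∀ x, c.inner (A.mulVec x) (A.mulVec x) = r ^ 2 * c.inner x x

/-- There is one inner product on `ℝ^d` for which every `A_i` is a similitude. -/
def AreSimultaneouslySimilitudes {d N : ℕ} (A : Fin N → GL (Fin d) ℝ) : Prop :=
  ∃ c : InnerProductSpace.Core ℝ (Fin d → ℝ),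
    ∀ i, IsSimilitudeFor c (A i : Matrix (Fin d) (Fin d) ℝ)

end

/-! Contraction and irreducibility are open conditions, and in their presence the other two become
open as well.

For a contracting tuple, bounds on the logarithms of the singular values of word products, linear in
the word length, make the pressure Lipschitz and strictly decreasing on [0, d]. Its endpoint values
are explicit: log N > 0 at 0, and log ∑ |det A_i| at d, because φ^d = |det| is multiplicative. So
(ii) says exactly that ∑ |det A_i| < 1 (`IsContractingTuple.affinityDimension_mem_Ioo_iff`), and
continuity of the pressure in the tuple is never needed. The limit defining the pressure exists by
Fekete's lemma, since φ^s is submultiplicative; this rests on Horn's inequality, obtained from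
Cauchy–Binet.

Failure of (iii), and failure of (iv) among irreducible tuples, are each witnessed by a point of a
compact set subject to closed conditions: a pair of unit vectors, respectively a positive
semidefinite form of trace 1. Projection along a compact set preserves closedness. Admitting
degenerate forms is harmless: the kernel of a form scaled by every A_i is invariant, so
irreducibility makes the form definite. -/

/-! ### Cauchy–Binet and the diagonal volume bound -/

open Matrix in
/-- A symmetrized form of the Cauchy–Binet formula for `Wᵀ D W` with `D` diagonal. -/
theorem factorial_mul_det_transpose_mul_diagonal_mul {n m : Type*} [Fintype n] [DecidableEq n]
    [Fintype m] [DecidableEq m] (W : Matrix n m ℝ) (D : n → ℝ) :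
    ((Fintype.card m).factorial : ℝ) * (Wᵀ * diagonal D * W).det =
      ∑ f : m → n, (∏ i, D (f i)) * (W.submatrix f id).det ^ 2 := by
  have hexp : (Wᵀ * diagonal D * W).det =
      ∑ f : m → n, (∏ i, W (f i) i * D (f i)) * (W.submatrix f id).det := by
    have h1 : (Wᵀ * diagonal D * W) = fun i => ∑ a, (W a i * D a) • W a := by
      ext i j
      simp [Matrix.mul_apply, Matrix.diagonal_apply, Finset.sum_apply]
    rw [h1]
    change (detRowAlternating : (m → ℝ) [⋀^m]→ₗ[ℝ] ℝ).toMultilinearMap _ = _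
    rw [MultilinearMap.map_sum]
    refine Finset.sum_congr rfl fun f _ => ?_
    rw [MultilinearMap.map_smul_univ]
    rfl
  -- Replacing f by f ∘ σ brings out the sign of σ; summing over all σ then assembles the leftover
  -- entries into a second copy of the minor. The factorial counts these repetitions.
  have hperm (σ : Equiv.Perm m) : (Wᵀ * diagonal D * W).det =
      ∑ f : m → n, (∏ i, D (f i)) * (W.submatrix f id).det *
        ((Equiv.Perm.sign σ : ℤ) * ∏ i, W (f (σ i)) i) := by
    rw [hexp, ← (Equiv.arrowCongr σ.symm (Equiv.refl n)).sum_comp]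
    refine Finset.sum_congr rfl fun f _ => ?_
    have h2 : (W.submatrix (fun i => f (σ i)) id).det =
        (Equiv.Perm.sign σ : ℤ) * (W.submatrix f id).det := by
      rw [← det_permute σ (W.submatrix f id)]; rfl
    have h3 : ∏ i, D (f (σ i)) = ∏ i, D (f i) := Equiv.prod_comp σ fun i => D (f i)
    change (∏ i, W (f (σ i)) i * D (f (σ i))) * (W.submatrix (fun i => f (σ i)) id).det = _
    rw [h2, Finset.prod_mul_distrib, h3]
    ring
  have hsum := Finset.sum_congr (rfl : (Finset.univ : Finset (Equiv.Perm m)) = _)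
    fun σ _ => hperm σ
  rw [Finset.sum_const, Finset.card_univ, Fintype.card_perm, nsmul_eq_mul,
    Finset.sum_comm] at hsum
  rw [hsum]
  refine Finset.sum_congr rfl fun f _ => ?_
  rw [← Finset.mul_sum, sq, ← mul_assoc]
  congr 1
  rw [Matrix.det_apply']
  rfl

/-- Induction on the maximum: the largest element of a finite set of naturals is at least the number
of the others. -/
theorem Antitone.prod_le_prod_range {a : ℕ → ℝ} (ha : Antitone a) (h0 : ∀ k, 0 ≤ a k)
    (s : Finset ℕ) : ∏ k ∈ s, a k ≤ ∏ k ∈ Finset.range s.card, a k := by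
  refine Finset.induction_on_max s (by simp) ?_
  · intro b s hb ih
    have hbs : b ∉ s := fun h => lt_irrefl _ (hb b h)
    have hcard : s.card ≤ b := by
      simpa using Finset.card_le_card
        (show s ⊆ Finset.range b from fun x hx => Finset.mem_range.2 (hb x hx))
    rw [Finset.prod_insert hbs, Finset.card_insert_of_notMem hbs, Finset.prod_range_succ, mul_comm]
    exact mul_le_mul ih (ha hcard) (h0 _) (Finset.prod_nonneg fun _ _ => h0 _)

-- Compare the Cauchy–Binet sums for D = a and D = 1 term by term: a repeated row kills the minor,
-- and m distinct rows carry a weight at most the product of the m largest a's.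
open Matrix in
theorem det_transpose_mul_diagonal_mul_le {d m : ℕ} (W : Matrix (Fin d) (Fin m) ℝ) {a : ℕ → ℝ}
    (ha : Antitone a) (h0 : ∀ k, 0 ≤ a k) :
    (Wᵀ * diagonal (fun i : Fin d => a i) * W).det ≤
      (∏ k ∈ Finset.range m, a k) * (Wᵀ * W).det := by
  have h1 := factorial_mul_det_transpose_mul_diagonal_mul W fun i : Fin d => a i
  have h2 := factorial_mul_det_transpose_mul_diagonal_mul W fun _ : Fin d => 1
  rw [show (diagonal fun _ : Fin d => (1 : ℝ)) = 1 from diagonal_one, Matrix.mul_one] at h2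
  have hpos : (0 : ℝ) < ((Fintype.card (Fin m)).factorial : ℝ) := by positivity
  refine le_of_mul_le_mul_left ?_ hpos
  rw [mul_left_comm, h1, h2, Finset.mul_sum]
  refine Finset.sum_le_sum fun f _ => ?_
  rw [Finset.prod_const_one, one_mul]
  by_cases hf : Function.Injective f
  · refine mul_le_mul_of_nonneg_right ?_ (sq_nonneg _)
    have hinj : Function.Injective fun i => (f i : ℕ) := Fin.val_injective.comp hf
    have h3 := ha.prod_le_prod_range h0 (Finset.univ.image fun i => (f i : ℕ))
    rwa [Finset.card_image_of_injective _ hinj, Finset.card_univ, Fintype.card_fin,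
      Finset.prod_image hinj.injOn] at h3
  · rw [Function.not_injective_iff] at hf
    obtain ⟨i, j, hij, hne⟩ := hf
    have : (W.submatrix f id).det = 0 := det_zero_of_row_eq hne (by ext k; simp [hij])
    simp [this]

/-! ### Singular value products as maximal volume distortion -/

section SingularValues

variable {d : ℕ}

theorem matrixSingularValue_nonneg (A : Matrix (Fin d) (Fin d) ℝ) (k : ℕ) :
    0 ≤ matrixSingularValue A k :=
  LinearMap.singularValues_nonneg _ _

theorem antitone_matrixSingularValue_succ (A : Matrix (Fin d) (Fin d) ℝ) :
    Antitone fun k => matrixSingularValue A (k + 1) := fun i j hij => by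
  simpa [matrixSingularValue] using LinearMap.singularValues_antitone _ hij

open Matrix in
/-- The spectral decomposition of `Aᵀ A`. -/
theorem exists_transpose_mul_self_eq (A : Matrix (Fin d) (Fin d) ℝ) :
    ∃ U : Matrix (Fin d) (Fin d) ℝ, Uᵀ * U = 1 ∧
      Aᵀ * A = U * diagonal (fun i : Fin d => matrixSingularValue A (i + 1) ^ 2) * Uᵀ := by
  set T := Matrix.toEuclideanLin A
  have hT := T.isSymmetric_adjoint_comp_self
  have hd : Module.finrank ℝ (EuclideanSpace ℝ (Fin d)) = d := by simp
  let b := hT.eigenvectorBasis hd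
  let U : Matrix (Fin d) (Fin d) ℝ := Matrix.of fun i j => b j i
  have hUU : Uᵀ * U = 1 := by
    ext i j
    have h := b.inner_eq_ite i j
    rw [PiLp.inner_apply] at h
    simp only [Matrix.mul_apply, Matrix.transpose_apply, Matrix.one_apply, U, Matrix.of_apply]
    rw [← h]
    exact Finset.sum_congr rfl fun k _ => by simp [mul_comm]
  have hAU : Aᵀ * A * U =
      U * diagonal (fun i : Fin d => matrixSingularValue A (i + 1) ^ 2) := by
    ext i j
    have h : LinearMap.adjoint T (T (b j)) = (T.singularValues j ^ 2) • b j := by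
      rw [LinearMap.sq_singularValues_fin T hd]
      exact hT.apply_eigenvectorBasis hd j
    rw [← Matrix.toEuclideanLin_conjTranspose_eq_adjoint] at h
    have h' := congrArg (fun v : EuclideanSpace ℝ (Fin d) => v i) h
    rw [Matrix.mul_diagonal]
    simp only [T, Matrix.conjTranspose_eq_transpose_of_trivial,
      Matrix.toLpLin_apply, Matrix.mulVec_mulVec] at h'
    simp only [matrixSingularValue, Nat.add_sub_cancel, U, Matrix.of_apply]
    rw [mul_comm]
    exact h'
  refine ⟨U, hUU, ?_⟩
  rw [← hAU, Matrix.mul_assoc _ U, mul_eq_one_comm.1 hUU, Matrix.mul_one]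

/-- The product of the `m` largest singular values. -/
noncomputable def topSingularValueProduct (A : Matrix (Fin d) (Fin d) ℝ) (m : ℕ) : ℝ :=
  ∏ k ∈ Finset.range m, matrixSingularValue A (k + 1)

theorem topSingularValueProduct_nonneg (A : Matrix (Fin d) (Fin d) ℝ) (m : ℕ) :
    0 ≤ topSingularValueProduct A m :=
  Finset.prod_nonneg fun _ _ => matrixSingularValue_nonneg _ _

-- Squared m-dimensional volumes are Gram determinants; diagonalizing AᵀA reduces their distortion
-- to the diagonal case.
open Matrix in
theorem det_transpose_mul_self_le (A : Matrix (Fin d) (Fin d) ℝ) {m : ℕ}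
    (V : Matrix (Fin d) (Fin m) ℝ) :
    ((A * V)ᵀ * (A * V)).det ≤ topSingularValueProduct A m ^ 2 * (Vᵀ * V).det := by
  obtain ⟨U, hU, hA⟩ := exists_transpose_mul_self_eq A
  have hU' : U * Uᵀ = 1 := mul_eq_one_comm.1 hU
  have h1 : (A * V)ᵀ * (A * V) = (Uᵀ * V)ᵀ *
      diagonal (fun i : Fin d => matrixSingularValue A (i + 1) ^ 2) * (Uᵀ * V) := by
    rw [Matrix.transpose_mul, Matrix.mul_assoc, ← Matrix.mul_assoc Aᵀ, hA]
    simp [Matrix.mul_assoc]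
  have h2 : Vᵀ * V = (Uᵀ * V)ᵀ * (Uᵀ * V) := by
    rw [Matrix.transpose_mul, Matrix.transpose_transpose, Matrix.mul_assoc, ← Matrix.mul_assoc U,
      hU', Matrix.one_mul]
  rw [h1, h2, topSingularValueProduct, ← Finset.prod_pow]
  exact det_transpose_mul_diagonal_mul_le _
    (a := fun k => matrixSingularValue A (k + 1) ^ 2)
    (fun i j hij => pow_le_pow_left₀ (matrixSingularValue_nonneg _ _)
      (antitone_matrixSingularValue_succ A hij) 2) fun _ => sq_nonneg _

-- The extremal frame consists of the first m eigenvectors of AᵀA. With the upper bound, this makes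
-- the product a maximum of volume distortion, whence its submultiplicativity.
open Matrix in
theorem exists_det_transpose_mul_self_eq (A : Matrix (Fin d) (Fin d) ℝ) {m : ℕ} (hm : m ≤ d) :
    ∃ V : Matrix (Fin d) (Fin m) ℝ, Vᵀ * V = 1 ∧
      ((A * V)ᵀ * (A * V)).det = topSingularValueProduct A m ^ 2 := by
  obtain ⟨U, hU, hA⟩ := exists_transpose_mul_self_eq A
  have hsub (M : Matrix (Fin d) (Fin d) ℝ) :
      (U.submatrix id (Fin.castLE hm))ᵀ * M * U.submatrix id (Fin.castLE hm) =
        (Uᵀ * M * U).submatrix (Fin.castLE hm) (Fin.castLE hm) := by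
    ext i j
    simp [Matrix.mul_apply]
  refine ⟨U.submatrix id (Fin.castLE hm), ?_, ?_⟩
  · have h := hsub 1
    rw [Matrix.mul_one, Matrix.mul_one, hU] at h
    rw [h, submatrix_one _ (Fin.castLE_injective hm)]
  · rw [Matrix.transpose_mul, Matrix.mul_assoc, ← Matrix.mul_assoc Aᵀ, ← Matrix.mul_assoc, hsub, hA]
    have h : Uᵀ * (U * diagonal (fun i : Fin d => matrixSingularValue A (i + 1) ^ 2) * Uᵀ) * U =
        diagonal (fun i : Fin d => matrixSingularValue A (i + 1) ^ 2) := by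
      rw [Matrix.mul_assoc, Matrix.mul_assoc _ Uᵀ, hU, Matrix.mul_one, ← Matrix.mul_assoc, hU,
        Matrix.one_mul]
    rw [h, submatrix_diagonal _ _ (Fin.castLE_injective hm), det_diagonal, topSingularValueProduct,
      ← Finset.prod_pow, ← Fin.prod_univ_eq_prod_range
        (fun k => matrixSingularValue A (k + 1) ^ 2)]
    rfl

/-- Horn's inequality. -/
theorem topSingularValueProduct_mul_le (A B : Matrix (Fin d) (Fin d) ℝ) {m : ℕ} (hm : m ≤ d) :
    topSingularValueProduct (A * B) m ≤
      topSingularValueProduct A m * topSingularValueProduct B m := by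
  obtain ⟨V, hV, hAB⟩ := exists_det_transpose_mul_self_eq (A * B) hm
  have h1 := det_transpose_mul_self_le A (B * V)
  have h2 := det_transpose_mul_self_le B V
  rw [hV, Matrix.det_one, mul_one] at h2
  rw [← Matrix.mul_assoc A, hAB] at h1
  refine le_of_sq_le_sq ?_ (mul_nonneg (topSingularValueProduct_nonneg _ _)
    (topSingularValueProduct_nonneg _ _))
  rw [mul_pow]
  exact h1.trans (mul_le_mul_of_nonneg_left h2 (sq_nonneg _))

theorem topSingularValueProduct_self (A : Matrix (Fin d) (Fin d) ℝ) :
    topSingularValueProduct A d = |A.det| := by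
  obtain ⟨V, hV, h⟩ := exists_det_transpose_mul_self_eq A le_rfl
  have hd : V.det ^ 2 = 1 := by
    rw [sq, ← Matrix.det_one (n := Fin d), ← hV, Matrix.det_mul, Matrix.det_transpose]
  rw [Matrix.det_mul, Matrix.det_transpose, ← sq, Matrix.det_mul, mul_pow, hd, mul_one] at h
  rw [← abs_of_nonneg (topSingularValueProduct_nonneg A d)]
  exact ((sq_eq_sq_iff_abs_eq_abs _ _).1 h).symm

/-- Converts bounds on the stretching of vectors, from either side, into bounds on every singular
value. -/
theorem exists_norm_toEuclideanLin_eq_matrixSingularValue (A : Matrix (Fin d) (Fin d) ℝ) {k : ℕ}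
    (hk : k < d) : ∃ u : EuclideanSpace ℝ (Fin d), ‖u‖ = 1 ∧
      ‖Matrix.toEuclideanLin A u‖ = matrixSingularValue A (k + 1) := by
  set T := Matrix.toEuclideanLin A
  have hT := T.isSymmetric_adjoint_comp_self
  have hd : Module.finrank ℝ (EuclideanSpace ℝ (Fin d)) = d := by simp
  refine ⟨hT.eigenvectorBasis hd ⟨k, hk⟩, (hT.eigenvectorBasis hd).norm_eq_one _, ?_⟩
  have h := hT.apply_eigenvectorBasis hd ⟨k, hk⟩
  have h2 : ‖T (hT.eigenvectorBasis hd ⟨k, hk⟩)‖ ^ 2 = matrixSingularValue A (k + 1) ^ 2 := by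
    rw [← real_inner_self_eq_norm_sq, ← LinearMap.adjoint_inner_left, ← LinearMap.comp_apply, h,
      ← LinearMap.sq_singularValues_fin]
    simp [real_inner_smul_left, matrixSingularValue, T]
  exact (sq_eq_sq₀ (norm_nonneg _) (matrixSingularValue_nonneg _ _)).1 h2

end SingularValues

/-! ### Interpolation weights -/

/-- The weights of the piecewise linear interpolation of partial sums. -/
noncomputable def interpolationWeight (s : ℝ) (k : ℕ) : ℝ := min 1 (max 0 (s - k))

theorem interpolationWeight_mono {s t : ℝ} (hst : s ≤ t) (k : ℕ) :
    interpolationWeight s k ≤ interpolationWeight t k :=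
  min_le_min_left _ (max_le_max_left _ (sub_le_sub_right hst _))

theorem sum_interpolationWeight_mul {d : ℕ} {s : ℝ} (hs : 0 ≤ s) (hsd : s ≤ d) (l : ℕ → ℝ) :
    ∑ k ∈ Finset.range d, interpolationWeight s k * l k =
      ∑ k ∈ Finset.range ⌊s⌋₊, l k + (s - ⌊s⌋₊) * l (⌈s⌉₊ - 1) := by
  have hfl : (⌊s⌋₊ : ℝ) ≤ s := Nat.floor_le hs
  have hlt : s < ⌊s⌋₊ + 1 := Nat.lt_floor_add_one s
  have hfd : ⌊s⌋₊ ≤ d := Nat.floor_le_of_le hsd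
  rw [← Finset.sum_range_add_sum_Ico _ hfd]
  congr 1
  · refine Finset.sum_congr rfl fun k hk => ?_
    have hk' : (k : ℝ) + 1 ≤ ⌊s⌋₊ := by exact_mod_cast Finset.mem_range.1 hk
    rw [interpolationWeight, max_eq_right (by linarith), min_eq_left (by linarith), one_mul]
  · have hzero : ∀ k : ℕ, ⌊s⌋₊ < k → interpolationWeight s k = 0 := fun k hk => by
      have hk' : (⌊s⌋₊ : ℝ) + 1 ≤ k := by exact_mod_cast hk
      rw [interpolationWeight, max_eq_left (by linarith), min_eq_right zero_le_one]
    have hfloor : interpolationWeight s ⌊s⌋₊ = s - ⌊s⌋₊ := by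
      rw [interpolationWeight, max_eq_right (by linarith), min_eq_right (by linarith)]
    -- At integer s the last coefficient vanishes, so the index `⌈s⌉₊ - 1`, truncated at s = 0, does
    -- not matter; otherwise it equals `⌊s⌋₊`.
    rcases hfl.eq_or_lt with heq | hlt'
    · rw [← heq]
      simp only [Nat.floor_natCast, sub_self, zero_mul]
      refine Finset.sum_eq_zero fun k hk => ?_
      rcases (Finset.mem_Ico.1 hk).1.eq_or_lt with h | h
      · rw [heq, ← h, hfloor, heq, sub_self, zero_mul]
      · rw [heq, hzero k h, zero_mul]
    · have hlt2 : ⌊s⌋₊ < d := by exact_mod_cast hlt'.trans_le hsd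
      have hceil : ⌈s⌉₊ = ⌊s⌋₊ + 1 := by
        rw [Nat.ceil_eq_iff (Nat.succ_ne_zero _)]
        push_cast
        exact ⟨by simpa using hlt', hlt.le⟩
      rw [Finset.sum_eq_single ⌊s⌋₊, hfloor, hceil, Nat.add_sub_cancel]
      · intro k hk hne
        rw [hzero k (lt_of_le_of_ne (Finset.mem_Ico.1 hk).1 hne.symm), zero_mul]
      · intro h
        exact absurd (Finset.mem_Ico.2 ⟨le_rfl, hlt2⟩) h

theorem sum_interpolationWeight {d : ℕ} {s : ℝ} (hs : 0 ≤ s) (hsd : s ≤ d) :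
    ∑ k ∈ Finset.range d, interpolationWeight s k = s := by
  simpa using sum_interpolationWeight_mul hs hsd fun _ => 1

/-! ### Submultiplicativity of φ^s and its dependence on s -/

section SingularValueFunction

variable {d : ℕ}

theorem prod_Icc_matrixSingularValue (A : Matrix (Fin d) (Fin d) ℝ) (m : ℕ) :
    ∏ k ∈ Finset.Icc 1 m, matrixSingularValue A k = topSingularValueProduct A m := by
  rw [topSingularValueProduct, Finset.range_eq_Ico,
    Finset.prod_Ico_add' (fun k => matrixSingularValue A k), zero_add]
  rfl

theorem singularValueFunction_self (A : Matrix (Fin d) (Fin d) ℝ) :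
    singularValueFunction d A = |A.det| := by
  rw [singularValueFunction, if_pos le_rfl, prod_Icc_matrixSingularValue, Nat.floor_natCast,
    sub_self, Real.rpow_zero, mul_one, topSingularValueProduct_self]

theorem singularValueFunction_zero (A : Matrix (Fin d) (Fin d) ℝ) :
    singularValueFunction 0 A = 1 := by
  simp [singularValueFunction]

/-- Individual singular values are not submultiplicative, but this geometric mean involves only
products of leading ones, to which Horn's inequality applies. -/
theorem singularValueFunction_eq_rpow_mul_rpow (A : Matrix (Fin d) (Fin d) ℝ) {s : ℝ} (hs : 0 ≤ s)
    (hsd : s < d) : singularValueFunction s A =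
      topSingularValueProduct A ⌊s⌋₊ ^ (1 - (s - ⌊s⌋₊)) *
        topSingularValueProduct A (⌊s⌋₊ + 1) ^ (s - ⌊s⌋₊) := by
  have hfl : (⌊s⌋₊ : ℝ) ≤ s := Nat.floor_le hs
  have hlt : s < ⌊s⌋₊ + 1 := Nat.lt_floor_add_one s
  rw [singularValueFunction, if_pos hsd.le, prod_Icc_matrixSingularValue]
  rw [show topSingularValueProduct A (⌊s⌋₊ + 1) =
    topSingularValueProduct A ⌊s⌋₊ * matrixSingularValue A (⌊s⌋₊ + 1) from
      Finset.prod_range_succ _ _]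
  rw [Real.mul_rpow (topSingularValueProduct_nonneg _ _) (matrixSingularValue_nonneg _ _),
    ← mul_assoc, ← Real.rpow_add_of_nonneg (topSingularValueProduct_nonneg _ _) (by linarith)
      (by linarith), sub_add_cancel, Real.rpow_one]
  congr 1
  rcases hfl.eq_or_lt with heq | hlt'
  · rw [sub_eq_zero.2 heq.symm, Real.rpow_zero, Real.rpow_zero]
  · have hceil : ⌈s⌉₊ = ⌊s⌋₊ + 1 := by
      rw [Nat.ceil_eq_iff (Nat.succ_ne_zero _)]
      push_cast
      exact ⟨by simpa using hlt', hlt.le⟩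
    rw [hceil]

theorem singularValueFunction_mul_le (A B : Matrix (Fin d) (Fin d) ℝ) {s : ℝ} (hs : 0 ≤ s)
    (hsd : s ≤ d) : singularValueFunction s (A * B) ≤
      singularValueFunction s A * singularValueFunction s B := by
  -- At s = d the index `⌊s⌋₊ + 1` would leave the range of Horn's inequality; there φ^d = |det|.
  rcases hsd.eq_or_lt with rfl | hlt
  · rw [singularValueFunction_self, singularValueFunction_self, singularValueFunction_self,
      Matrix.det_mul, abs_mul]
  have hfl : (⌊s⌋₊ : ℝ) ≤ s := Nat.floor_le hs
  have hlt1 : s < ⌊s⌋₊ + 1 := Nat.lt_floor_add_one s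
  have hfd : ⌊s⌋₊ < d := (Nat.floor_lt hs).2 hlt
  rw [singularValueFunction_eq_rpow_mul_rpow _ hs hlt, singularValueFunction_eq_rpow_mul_rpow _ hs hlt,
    singularValueFunction_eq_rpow_mul_rpow _ hs hlt, mul_mul_mul_comm,
    ← Real.mul_rpow (topSingularValueProduct_nonneg _ _) (topSingularValueProduct_nonneg _ _),
    ← Real.mul_rpow (topSingularValueProduct_nonneg _ _) (topSingularValueProduct_nonneg _ _)]
  refine mul_le_mul ?_ ?_ (Real.rpow_nonneg (topSingularValueProduct_nonneg _ _) _)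
    (Real.rpow_nonneg (mul_nonneg (topSingularValueProduct_nonneg _ _)
      (topSingularValueProduct_nonneg _ _)) _)
  · exact Real.rpow_le_rpow (topSingularValueProduct_nonneg _ _)
      (topSingularValueProduct_mul_le A B hfd.le) (by linarith)
  · exact Real.rpow_le_rpow (topSingularValueProduct_nonneg _ _)
      (topSingularValueProduct_mul_le A B hfd) (by linarith)

theorem matrixSingularValue_pos (A : GL (Fin d) ℝ) {k : ℕ} (hk : k < d) :
    0 < matrixSingularValue (A : Matrix (Fin d) (Fin d) ℝ) (k + 1) := by
  refine lt_of_le_of_ne (matrixSingularValue_nonneg _ _) fun h => ?_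
  have h1 := topSingularValueProduct_self (A : Matrix (Fin d) (Fin d) ℝ)
  have h2 : topSingularValueProduct (A : Matrix (Fin d) (Fin d) ℝ) d = 0 :=
    Finset.prod_eq_zero (Finset.mem_range.2 hk) h.symm
  rw [h2] at h1
  exact Matrix.GeneralLinearGroup.det_ne_zero A (abs_eq_zero.1 h1.symm)

theorem singularValueFunction_eq_exp (A : GL (Fin d) ℝ) {s : ℝ} (hs : 0 ≤ s) (hsd : s ≤ d) :
    singularValueFunction s (A : Matrix (Fin d) (Fin d) ℝ) =
      Real.exp (∑ k ∈ Finset.range d, interpolationWeight s k *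
        Real.log (matrixSingularValue (A : Matrix (Fin d) (Fin d) ℝ) (k + 1))) := by
  rw [sum_interpolationWeight_mul hs hsd
      fun k => Real.log (matrixSingularValue (A : Matrix (Fin d) (Fin d) ℝ) (k + 1)),
    Real.exp_add, Real.exp_sum, singularValueFunction, if_pos hsd, prod_Icc_matrixSingularValue]
  congr 1
  · refine Finset.prod_congr rfl fun k hk => ?_
    rw [Real.exp_log (matrixSingularValue_pos A ((Finset.mem_range.1 hk).trans_le
      (Nat.floor_le_of_le hsd)))]
  · rcases Nat.eq_zero_or_pos ⌈s⌉₊ with h0 | hpos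
    · have : s = 0 := le_antisymm (Nat.ceil_eq_zero.1 h0) hs
      simp [this]
    · have hc : ⌈s⌉₊ - 1 + 1 = ⌈s⌉₊ := Nat.sub_add_cancel hpos
      have hcd : ⌈s⌉₊ ≤ d := Nat.ceil_le.2 hsd
      have hp := matrixSingularValue_pos A (k := ⌈s⌉₊ - 1) (by omega)
      rw [Real.rpow_def_of_pos (by rwa [hc] at hp), hc, mul_comm]

theorem singularValueFunction_pos (A : GL (Fin d) ℝ) {s : ℝ} (hs : 0 ≤ s) (hsd : s ≤ d) :
    0 < singularValueFunction s (A : Matrix (Fin d) (Fin d) ℝ) := by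
  rw [singularValueFunction_eq_exp A hs hsd]
  exact Real.exp_pos _

/-- log φ^s is a weighted sum of the log σ_k whose weights increase with s and add up to s, so
passing from s to t adds weight t - s in total. -/
theorem singularValueFunction_le_mul_exp (A : GL (Fin d) ℝ) {s t b : ℝ} (hs : 0 ≤ s) (hst : s ≤ t)
    (htd : t ≤ d)
    (hb : ∀ k < d, Real.log (matrixSingularValue (A : Matrix (Fin d) (Fin d) ℝ) (k + 1)) ≤ b) :
    singularValueFunction t (A : Matrix (Fin d) (Fin d) ℝ) ≤
      singularValueFunction s (A : Matrix (Fin d) (Fin d) ℝ) * Real.exp ((t - s) * b) := by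
  rw [singularValueFunction_eq_exp A hs (hst.trans htd),
    singularValueFunction_eq_exp A (hs.trans hst) htd, ← Real.exp_add, Real.exp_le_exp,
    ← sub_le_iff_le_add', ← Finset.sum_sub_distrib]
  nth_rewrite 2 [← sum_interpolationWeight (hs.trans hst) htd]
  nth_rewrite 2 [← sum_interpolationWeight hs (hst.trans htd)]
  rw [← Finset.sum_sub_distrib, Finset.sum_mul]
  refine Finset.sum_le_sum fun k hk => ?_
  rw [← sub_mul]
  exact mul_le_mul_of_nonneg_left (hb k (Finset.mem_range.1 hk))
    (sub_nonneg.2 (interpolationWeight_mono hst k))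

theorem mul_exp_le_singularValueFunction (A : GL (Fin d) ℝ) {s t b : ℝ} (hs : 0 ≤ s) (hst : s ≤ t)
    (htd : t ≤ d)
    (hb : ∀ k < d, b ≤ Real.log (matrixSingularValue (A : Matrix (Fin d) (Fin d) ℝ) (k + 1))) :
    singularValueFunction s (A : Matrix (Fin d) (Fin d) ℝ) * Real.exp ((t - s) * b) ≤
      singularValueFunction t (A : Matrix (Fin d) (Fin d) ℝ) := by
  rw [singularValueFunction_eq_exp A hs (hst.trans htd),
    singularValueFunction_eq_exp A (hs.trans hst) htd, ← Real.exp_add, Real.exp_le_exp,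
    ← le_sub_iff_add_le', ← Finset.sum_sub_distrib]
  nth_rewrite 1 [← sum_interpolationWeight (hs.trans hst) htd]
  nth_rewrite 1 [← sum_interpolationWeight hs (hst.trans htd)]
  rw [← Finset.sum_sub_distrib, Finset.sum_mul]
  refine Finset.sum_le_sum fun k hk => ?_
  rw [← sub_mul]
  exact mul_le_mul_of_nonneg_left (hb k (Finset.mem_range.1 hk))
    (sub_nonneg.2 (interpolationWeight_mono hst k))

end SingularValueFunction

/-! ### Comparison of norms in finite dimension -/

theorem Seminorm.continuous_of_finiteDimensional {E : Type*} [NormedAddCommGroup E]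
    [NormedSpace ℝ E] [FiniteDimensional ℝ E] (p : Seminorm ℝ E) : Continuous p :=
  continuousOn_univ.1 (p.convexOn.continuousOn isOpen_univ)

theorem Seminorm.exists_norm_le_mul {E : Type*} [NormedAddCommGroup E]
    [NormedSpace ℝ E] [FiniteDimensional ℝ E] (p : Seminorm ℝ E) (hp : ∀ x, p x = 0 → x = 0) :
    ∃ C : ℝ, 0 < C ∧ ∀ x, ‖x‖ ≤ C * p x := by
  have : ProperSpace E := FiniteDimensional.proper_real E
  rcases (Metric.sphere (0 : E) 1).eq_empty_or_nonempty with h | hne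
  · refine ⟨1, one_pos, fun x => ?_⟩
    by_cases hx : x = 0
    · simp [hx]
    · exfalso
      have : ‖x‖⁻¹ • x ∈ Metric.sphere (0 : E) 1 := by
        simp [norm_smul, hx]
      rw [h] at this
      exact this
  · obtain ⟨y, hy, hmin⟩ := (isCompact_sphere (0 : E) 1).exists_isMinOn hne
      p.continuous_of_finiteDimensional.continuousOn
    have hy0 : y ≠ 0 := by
      rintro rfl
      simp at hy
    have hpy : 0 < p y := lt_of_le_of_ne (apply_nonneg p y) fun h => hy0 (hp y h.symm)
    refine ⟨(p y)⁻¹, inv_pos.2 hpy, fun x => ?_⟩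
    by_cases hx : x = 0
    · simp [hx]
    have hx' : 0 < ‖x‖ := norm_pos_iff.2 hx
    have h1 : ‖x‖⁻¹ • x ∈ Metric.sphere (0 : E) 1 := by simp [norm_smul, hx]
    have h2 : p y ≤ p (‖x‖⁻¹ • x) := hmin h1
    rw [map_smul_eq_mul, norm_inv, norm_norm] at h2
    rw [inv_mul_eq_div, le_div_iff₀ hpy]
    rwa [inv_mul_eq_div, le_div_iff₀ hx', mul_comm] at h2

/-! ### Word products, pressure and affinity dimension -/

section Words

variable {d N : ℕ} (A : Fin N → GL (Fin d) ℝ)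

theorem wordProduct_append {n m : ℕ} (i : Fin n → Fin N) (j : Fin m → Fin N) :
    wordProduct A (Fin.append i j) = wordProduct A j * wordProduct A i := by
  have h : (fun k => A (Fin.append i j k)) = Fin.append (fun k => A (i k)) fun k => A (j k) := by
    funext k
    refine Fin.addCases (fun k => ?_) (fun k => ?_) k <;> simp
  rw [wordProduct, h, List.ofFn_fin_append, List.reverse_append, List.prod_append]
  rfl

theorem wordProduct_succ {n : ℕ} (i : Fin (n + 1) → Fin N) :
    wordProduct A i = wordProduct A (Fin.tail i) * A (i 0) := by
  rw [wordProduct, List.ofFn_succ, List.reverse_cons, List.prod_append, List.prod_singleton]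
  rfl

theorem map_wordProduct {M : Type*} [CommMonoid M] (f : GL (Fin d) ℝ →* M) {n : ℕ}
    (i : Fin n → Fin N) : f (wordProduct A i) = ∏ k, f (A (i k)) := by
  rw [wordProduct, map_list_prod, List.map_reverse, List.prod_reverse, List.map_ofFn,
    List.prod_ofFn]
  rfl

theorem abs_det_wordProduct {n : ℕ} (i : Fin n → Fin N) :
    |(wordProduct A i : Matrix (Fin d) (Fin d) ℝ).det| =
      ∏ k, |(A (i k) : Matrix (Fin d) (Fin d) ℝ).det| := by
  let f : GL (Fin d) ℝ →* ℝ :=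
    ((absHom : ℝ →*₀ ℝ).toMonoidHom.comp Matrix.detMonoidHom).comp (Units.coeHom _)
  exact map_wordProduct A f i

theorem wordProduct_mulVec_le {q : (Fin d → ℝ) → ℝ} {c : ℝ} (hc : 0 ≤ c)
    (h : ∀ i x, q ((A i : Matrix (Fin d) (Fin d) ℝ).mulVec x) ≤ c * q x) {n : ℕ}
    (i : Fin n → Fin N) (x : Fin d → ℝ) :
    q ((wordProduct A i : Matrix (Fin d) (Fin d) ℝ).mulVec x) ≤ c ^ n * q x := by
  induction n generalizing x with
  | zero => simp [wordProduct]
  | succ n ih =>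
    rw [wordProduct_succ, Units.val_mul, ← Matrix.mulVec_mulVec, pow_succ, mul_assoc]
    exact (ih _ _).trans (mul_le_mul_of_nonneg_left (h _ _) (pow_nonneg hc _))

theorem le_wordProduct_mulVec {q : (Fin d → ℝ) → ℝ} {c : ℝ} (hc : 0 ≤ c)
    (h : ∀ i x, c * q x ≤ q ((A i : Matrix (Fin d) (Fin d) ℝ).mulVec x)) {n : ℕ}
    (i : Fin n → Fin N) (x : Fin d → ℝ) :
    c ^ n * q x ≤ q ((wordProduct A i : Matrix (Fin d) (Fin d) ℝ).mulVec x) := by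
  induction n generalizing x with
  | zero => simp [wordProduct]
  | succ n ih =>
    rw [wordProduct_succ, Units.val_mul, ← Matrix.mulVec_mulVec, pow_succ, mul_assoc]
    exact (mul_le_mul_of_nonneg_left (h _ _) (pow_nonneg hc _)).trans (ih _ _)

theorem exists_mul_norm_le_toEuclideanLin :
    ∃ c : ℝ, 0 < c ∧ ∀ i x, c * ‖WithLp.toLp 2 x‖ ≤
      ‖WithLp.toLp 2 ((A i : Matrix (Fin d) (Fin d) ℝ).mulVec x)‖ := by
  let T : Fin N → EuclideanSpace ℝ (Fin d) →L[ℝ] EuclideanSpace ℝ (Fin d) := fun i =>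
    (Matrix.toEuclideanLin ((A i)⁻¹ : GL (Fin d) ℝ).1).toContinuousLinearMap
  have hC : 0 < ∑ i, ‖T i‖ + 1 := by positivity
  refine ⟨(∑ i, ‖T i‖ + 1)⁻¹, inv_pos.2 hC, fun i x => ?_⟩
  rw [inv_mul_le_iff₀ hC]
  have h1 : T i (WithLp.toLp 2 ((A i : Matrix (Fin d) (Fin d) ℝ).mulVec x)) = WithLp.toLp 2 x := by
    simp only [T, LinearMap.coe_toContinuousLinearMap', Matrix.toLpLin_apply, Matrix.mulVec_mulVec]
    rw [← Units.val_mul, inv_mul_cancel, Units.val_one, Matrix.one_mulVec]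
  calc ‖WithLp.toLp 2 x‖
      ≤ ‖T i‖ * ‖WithLp.toLp 2 ((A i : Matrix (Fin d) (Fin d) ℝ).mulVec x)‖ := by
        rw [← h1]
        exact (T i).le_opNorm _
    _ ≤ _ := mul_le_mul_of_nonneg_right
        ((Finset.single_le_sum (f := fun i => ‖T i‖) (fun _ _ => norm_nonneg _)
          (Finset.mem_univ i)).trans (by linarith)) (norm_nonneg _)

theorem exists_le_log_matrixSingularValue_wordProduct :
    ∃ a : ℝ, ∀ (n : ℕ) (i : Fin n → Fin N), ∀ k < d,
      n * a ≤ Real.log (matrixSingularValue (wordProduct A i : Matrix (Fin d) (Fin d) ℝ) (k + 1)) := by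
  obtain ⟨c, hc, h⟩ := exists_mul_norm_le_toEuclideanLin A
  refine ⟨Real.log c, fun n i k hk => ?_⟩
  obtain ⟨u, hu, hσ⟩ := exists_norm_toEuclideanLin_eq_matrixSingularValue
    (wordProduct A i : Matrix (Fin d) (Fin d) ℝ) hk
  rw [← Real.log_pow]
  refine Real.log_le_log (pow_pos hc n) ?_
  rw [← hσ]
  have h1 := le_wordProduct_mulVec A (q := fun x => ‖WithLp.toLp 2 x‖) hc.le h i u.ofLp
  simp only [WithLp.toLp_ofLp, hu, mul_one] at h1
  exact h1

/-- Words contract geometrically in the adapted norm; passing to the Euclidean norm costs a constant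
b' independent of n, which disappears after division by n. -/
theorem IsContractingTuple.exists_log_matrixSingularValue_wordProduct_le {A : Fin N → GL (Fin d) ℝ}
    (hA : IsContractingTuple A) : ∃ b b' : ℝ, b < 0 ∧ ∀ (n : ℕ) (i : Fin n → Fin N), ∀ k < d,
      Real.log (matrixSingularValue (wordProduct A i : Matrix (Fin d) (Fin d) ℝ) (k + 1)) ≤
        n * b + b' := by
  obtain ⟨p, hp, hc⟩ := hA
  choose c hc1 hcp using hc
  obtain ⟨r, hr1, hr⟩ : ∃ r : ℝ, r < 1 ∧ ∀ i, c i ≤ r := by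
    rcases isEmpty_or_nonempty (Fin N) with h | h
    · exact ⟨0, one_pos, fun i => h.elim i⟩
    · obtain ⟨i, hi⟩ := Finite.exists_max c
      exact ⟨c i, hc1 i, hi⟩
  -- The maximum with 1/2 keeps the rate positive, so that its logarithm is negative.
  set r' := max r (1 / 2)
  have hr'0 : 0 < r' := lt_max_of_lt_right (by norm_num)
  have hr'1 : r' < 1 := max_lt hr1 (by norm_num)
  let q : Seminorm ℝ (EuclideanSpace ℝ (Fin d)) :=
    p.comp (WithLp.linearEquiv 2 ℝ (Fin d → ℝ)).toLinearMap
  have hq (x : EuclideanSpace ℝ (Fin d)) : q x = p x.ofLp := rfl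
  obtain ⟨C, hC, hle⟩ := q.exists_norm_le_mul fun x hx => by
    have := hp _ ((hq x).symm.trans hx)
    simpa using this
  obtain ⟨C', hC', hle'⟩ := q.bound_of_continuous_normedSpace q.continuous_of_finiteDimensional
  refine ⟨Real.log r', Real.log (C * C'), Real.log_neg hr'0 hr'1, fun n i k hk => ?_⟩
  obtain ⟨u, hu, hσ⟩ := exists_norm_toEuclideanLin_eq_matrixSingularValue
    (wordProduct A i : Matrix (Fin d) (Fin d) ℝ) hk
  rw [← Real.log_pow, ← Real.log_mul (pow_pos hr'0 n).ne' (mul_pos hC hC').ne']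
  refine Real.log_le_log (matrixSingularValue_pos _ hk) ?_
  have hword := wordProduct_mulVec_le A (q := p) hr'0.le (fun i x => (hcp i x).trans
    (mul_le_mul_of_nonneg_right ((hr i).trans (le_max_left _ _)) (apply_nonneg p x))) i u.ofLp
  have hu' := hle' u
  rw [hu, mul_one, hq] at hu'
  rw [← hσ]
  calc _ ≤ C * p ((wordProduct A i : Matrix (Fin d) (Fin d) ℝ).mulVec u.ofLp) := hle _
    _ ≤ C * (r' ^ n * C') := by
      gcongr
      exact hword.trans (mul_le_mul_of_nonneg_left hu' (pow_pos hr'0 n).le)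
    _ = _ := by ring

/-- The sum of `φ^s` over all words of length `n`. -/
noncomputable def wordSum (s : ℝ) (n : ℕ) : ℝ :=
  ∑ i : Fin n → Fin N, singularValueFunction s (wordProduct A i : Matrix (Fin d) (Fin d) ℝ)

theorem wordSum_pos [NeZero N] {s : ℝ} (hs : 0 ≤ s) (hsd : s ≤ d) (n : ℕ) : 0 < wordSum A s n :=
  Finset.sum_pos (fun _ _ => singularValueFunction_pos _ hs hsd) Finset.univ_nonempty

theorem wordSum_zero_left (n : ℕ) : wordSum A 0 n = (N : ℝ) ^ n := by
  simp [wordSum, singularValueFunction_zero]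

theorem wordSum_natCast (n : ℕ) :
    wordSum A d n = (∑ i, |(A i : Matrix (Fin d) (Fin d) ℝ).det|) ^ n := by
  rw [Fintype.sum_pow]
  exact Finset.sum_congr rfl fun i _ => by rw [singularValueFunction_self, abs_det_wordProduct]

theorem wordSum_add_le {s : ℝ} (hs : 0 ≤ s) (hsd : s ≤ d) (n m : ℕ) :
    wordSum A s (n + m) ≤ wordSum A s n * wordSum A s m := by
  rw [wordSum, wordSum, wordSum, ← (Fin.appendEquiv n m).sum_comp, Fintype.sum_prod_type,
    Finset.sum_mul_sum]
  refine Finset.sum_le_sum fun i _ => Finset.sum_le_sum fun j _ => ?_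
  change singularValueFunction s (wordProduct A (Fin.append i j) : Matrix (Fin d) (Fin d) ℝ) ≤ _
  rw [wordProduct_append, Units.val_mul, mul_comm]
  exact singularValueFunction_mul_le _ _ hs hsd

theorem subadditive_log_wordSum [NeZero N] {s : ℝ} (hs : 0 ≤ s) (hsd : s ≤ d) :
    Subadditive fun n => Real.log (wordSum A s n) := fun n m => by
  rw [← Real.log_mul (wordSum_pos A hs hsd n).ne' (wordSum_pos A hs hsd m).ne']
  exact Real.log_le_log (wordSum_pos A hs hsd _) (wordSum_add_le A hs hsd n m)

theorem log_wordSum_le [NeZero N] {s t b : ℝ} (hs : 0 ≤ s) (hst : s ≤ t) (htd : t ≤ d) {n : ℕ}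
    (hb : ∀ i : Fin n → Fin N, ∀ k < d, Real.log (matrixSingularValue
      (wordProduct A i : Matrix (Fin d) (Fin d) ℝ) (k + 1)) ≤ b) :
    Real.log (wordSum A t n) ≤ Real.log (wordSum A s n) + (t - s) * b := by
  rw [← Real.log_exp ((t - s) * b),
    ← Real.log_mul (wordSum_pos A hs (hst.trans htd) n).ne' (Real.exp_pos _).ne']
  refine Real.log_le_log (wordSum_pos A (hs.trans hst) htd n) ?_
  rw [wordSum, wordSum, Finset.sum_mul]
  exact Finset.sum_le_sum fun i _ => singularValueFunction_le_mul_exp _ hs hst htd (hb i)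

theorem le_log_wordSum [NeZero N] {s t b : ℝ} (hs : 0 ≤ s) (hst : s ≤ t) (htd : t ≤ d) {n : ℕ}
    (hb : ∀ i : Fin n → Fin N, ∀ k < d, b ≤ Real.log (matrixSingularValue
      (wordProduct A i : Matrix (Fin d) (Fin d) ℝ) (k + 1))) :
    Real.log (wordSum A s n) + (t - s) * b ≤ Real.log (wordSum A t n) := by
  rw [← Real.log_exp ((t - s) * b),
    ← Real.log_mul (wordSum_pos A hs (hst.trans htd) n).ne' (Real.exp_pos _).ne']
  refine Real.log_le_log (mul_pos (wordSum_pos A hs (hst.trans htd) n) (Real.exp_pos _)) ?_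
  rw [wordSum, wordSum, Finset.sum_mul]
  exact Finset.sum_le_sum fun i _ => mul_exp_le_singularValueFunction _ hs hst htd (hb i)

/-- Fekete's lemma shows that `limUnder` is a genuine limit here. The lower bound it needs comes
from comparison with s = 0, where the sum is N ^ n. -/
theorem tendsto_singularValuePressure [NeZero N] {s : ℝ} (hs : 0 ≤ s) (hsd : s ≤ d) :
    Tendsto (fun n : ℕ => Real.log (wordSum A s n) / n) atTop
      (𝓝 (singularValuePressure A s)) := by
  have hsub := subadditive_log_wordSum A hs hsd
  have hbdd : BddBelow (Set.range fun n : ℕ => Real.log (wordSum A s n) / n) := by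
    obtain ⟨a, ha⟩ := exists_le_log_matrixSingularValue_wordProduct A
    refine ⟨-|s * a|, ?_⟩
    rintro _ ⟨n, rfl⟩
    rcases Nat.eq_zero_or_pos n with rfl | hn
    · simpa using abs_nonneg (s * a)
    have hn' : (0 : ℝ) < n := by exact_mod_cast hn
    have h := le_log_wordSum A le_rfl hs hsd (ha n)
    rw [wordSum_zero_left, Real.log_pow, sub_zero] at h
    have hN : 0 ≤ Real.log N := Real.log_natCast_nonneg N
    rw [le_div_iff₀ hn']
    have h1 : -|s * a| * n ≤ s * a * n := mul_le_mul_of_nonneg_right (neg_abs_le _) hn'.le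
    have h2 : 0 ≤ n * Real.log N := mul_nonneg hn'.le hN
    linarith
  have h := hsub.tendsto_lim hbdd
  have heq : singularValuePressure A s = hsub.lim := by
    refine Tendsto.limUnder_eq ?_
    refine h.congr fun n => ?_
    rw [one_div, inv_mul_eq_div]
    rfl
  rwa [heq]

theorem singularValuePressure_zero [NeZero N] : singularValuePressure A 0 = Real.log N := by
  refine tendsto_nhds_unique (tendsto_singularValuePressure A le_rfl (Nat.cast_nonneg d))
    (tendsto_const_nhds.congr' ?_)
  filter_upwards [eventually_ne_atTop 0] with n hn
  have hn' : (n : ℝ) ≠ 0 := by exact_mod_cast hn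
  rw [wordSum_zero_left, Real.log_pow, mul_div_cancel_left₀ _ hn']

theorem singularValuePressure_natCast [NeZero N] : singularValuePressure A d =
    Real.log (∑ i, |(A i : Matrix (Fin d) (Fin d) ℝ).det|) := by
  refine tendsto_nhds_unique (tendsto_singularValuePressure A (Nat.cast_nonneg d) le_rfl)
    (tendsto_const_nhds.congr' ?_)
  filter_upwards [eventually_ne_atTop 0] with n hn
  have hn' : (n : ℝ) ≠ 0 := by exact_mod_cast hn
  rw [wordSum_natCast, Real.log_pow, mul_div_cancel_left₀ _ hn']

theorem exists_mul_le_singularValuePressure_sub [NeZero N] : ∃ a : ℝ, ∀ s t : ℝ, 0 ≤ s → s ≤ t →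
    t ≤ d → singularValuePressure A s + (t - s) * a ≤ singularValuePressure A t := by
  obtain ⟨a, ha⟩ := exists_le_log_matrixSingularValue_wordProduct A
  refine ⟨a, fun s t hs hst htd => ?_⟩
  refine le_of_tendsto_of_tendsto
    ((tendsto_singularValuePressure A hs (hst.trans htd)).add_const _)
    (tendsto_singularValuePressure A (hs.trans hst) htd) ?_
  filter_upwards [eventually_gt_atTop 0] with n hn
  have hn' : (0 : ℝ) < n := by exact_mod_cast hn
  have h := le_log_wordSum A hs hst htd (ha n)
  rw [le_div_iff₀ hn', add_mul, div_mul_cancel₀ _ hn'.ne']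
  linarith

theorem IsContractingTuple.exists_singularValuePressure_sub_le [NeZero N]
    {A : Fin N → GL (Fin d) ℝ} (hA : IsContractingTuple A) : ∃ b : ℝ, b < 0 ∧ ∀ s t : ℝ, 0 ≤ s →
      s ≤ t → t ≤ d → singularValuePressure A t ≤ singularValuePressure A s + (t - s) * b := by
  obtain ⟨b, b', hb, hle⟩ := hA.exists_log_matrixSingularValue_wordProduct_le
  refine ⟨b, hb, fun s t hs hst htd => ?_⟩
  have hlim : Tendsto (fun n : ℕ => Real.log (wordSum A s n) / n + (t - s) * b +
      (t - s) * b' / n) atTop (𝓝 (singularValuePressure A s + (t - s) * b + 0)) :=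
    ((tendsto_singularValuePressure A hs (hst.trans htd)).add_const _).add
      (tendsto_const_div_atTop_nhds_zero_nat _)
  rw [add_zero] at hlim
  refine le_of_tendsto_of_tendsto (tendsto_singularValuePressure A (hs.trans hst) htd) hlim ?_
  filter_upwards [eventually_gt_atTop 0] with n hn
  have hn' : (0 : ℝ) < n := by exact_mod_cast hn
  have h := log_wordSum_le A hs hst htd (hle n)
  rw [div_le_iff₀ hn', add_mul, add_mul, div_mul_cancel₀ _ hn'.ne', div_mul_cancel₀ _ hn'.ne']
  linarith

theorem IsContractingTuple.continuousOn_singularValuePressure [NeZero N] {A : Fin N → GL (Fin d) ℝ}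
    (hA : IsContractingTuple A) : ContinuousOn (singularValuePressure A) (Set.Icc 0 d) := by
  obtain ⟨a, ha⟩ := exists_mul_le_singularValuePressure_sub A
  obtain ⟨b, hb, hle⟩ := hA.exists_singularValuePressure_sub_le
  have hlip : LipschitzOnWith ‖a‖₊ (singularValuePressure A) (Set.Icc 0 d) := by
    refine LipschitzOnWith.of_le_add_mul _ fun s hs t ht => ?_
    rw [Real.dist_eq, coe_nnnorm, Real.norm_eq_abs]
    rcases le_total s t with h | h
    · have h1 := ha s t hs.1 h ht.2
      rw [abs_sub_comm, abs_of_nonneg (sub_nonneg.2 h)]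
      nlinarith [neg_abs_le a, sub_nonneg.2 h]
    · have h1 := hle t s ht.1 h hs.2
      have h2 : (s - t) * b ≤ 0 := mul_nonpos_of_nonneg_of_nonpos (sub_nonneg.2 h) hb.le
      have h3 : 0 ≤ |a| * |s - t| := by positivity
      linarith
  exact hlip.continuousOn

/-- The affinity dimension of a contracting tuple lies strictly between `0` and `d` exactly when
the pressure at `d` is negative. -/
theorem IsContractingTuple.affinityDimension_mem_Ioo_iff {A : Fin N → GL (Fin d) ℝ}
    (hA : IsContractingTuple A) (hN : 2 ≤ N) (hd : 0 < d) :
    (0 < affinityDimension A ∧ affinityDimension A < d) ↔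
      ∑ i, |(A i : Matrix (Fin d) (Fin d) ℝ).det| < 1 := by
  have : NeZero N := ⟨by omega⟩
  have hd' : (0 : ℝ) < d := by exact_mod_cast hd
  have hdet : 0 < ∑ i, |(A i : Matrix (Fin d) (Fin d) ℝ).det| :=
    Finset.sum_pos (fun i _ => abs_pos.2 (Matrix.GeneralLinearGroup.det_ne_zero _))
      Finset.univ_nonempty
  have hlogN : 0 < Real.log N := Real.log_pos (by exact_mod_cast hN)
  have hbdd : BddBelow {s : ℝ | 0 ≤ s ∧ singularValuePressure A s = 0} := ⟨0, fun s hs => hs.1⟩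
  constructor
  · rintro ⟨h0, h1⟩
    -- With no zero, `sInf` would take its default value 0, contrary to `h0`.
    have hne : {s : ℝ | 0 ≤ s ∧ singularValuePressure A s = 0}.Nonempty := by
      by_contra hne
      rw [Set.not_nonempty_iff_eq_empty] at hne
      rw [affinityDimension, hne, Real.sInf_empty] at h0
      exact lt_irrefl _ h0
    obtain ⟨s, ⟨hs0, hsP⟩, hsd⟩ := exists_lt_of_csInf_lt hne h1
    obtain ⟨b, hb, hle⟩ := hA.exists_singularValuePressure_sub_le
    have h := hle s d hs0 hsd.le le_rfl
    rw [hsP, zero_add, singularValuePressure_natCast] at h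
    exact (Real.log_neg_iff hdet).1
      (h.trans_lt (mul_neg_of_pos_of_neg (sub_pos.2 hsd) hb))
  · intro h
    have hPd : singularValuePressure A d < 0 := by
      rw [singularValuePressure_natCast]
      exact (Real.log_neg_iff hdet).2 h
    have hP0 : 0 < singularValuePressure A 0 := by rwa [singularValuePressure_zero]
    obtain ⟨s, hs, hsP⟩ := intermediate_value_Icc' hd'.le hA.continuousOn_singularValuePressure
      ⟨hPd.le, hP0.le⟩
    have hsd : s < d := lt_of_le_of_ne hs.2 fun h => by
      rw [h] at hsP
      exact hPd.ne hsP
    refine ⟨?_, (csInf_le hbdd ⟨hs.1, hsP⟩).trans_lt hsd⟩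
    obtain ⟨a, ha⟩ := exists_mul_le_singularValuePressure_sub A
    -- Below this threshold the pressure is at least log N - t|a| > 0, so the zeros stay away from 0
    -- and their infimum is positive.
    have hpos : 0 < min (d : ℝ) (Real.log N / (|a| + 1)) := by positivity
    refine hpos.trans_le (le_csInf ⟨s, hs.1, hsP⟩ ?_)
    rintro t ⟨ht0, htP⟩
    by_contra! hlt
    have h1 := ha 0 t le_rfl ht0 (hlt.le.trans (min_le_left _ _))
    have h2 := hlt.trans_le (min_le_right _ _)
    rw [lt_div_iff₀ (by positivity)] at h2
    rw [htP, singularValuePressure_zero, sub_zero] at h1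
    have h3 : -(t * |a|) ≤ t * a := by
      rw [← mul_neg]
      exact mul_le_mul_of_nonneg_left (neg_abs_le a) ht0
    linarith

end Words

/-! ### Projection along a compact set -/

theorem IsCompact.isClosed_exists_mem {X Y : Type*} [TopologicalSpace X] [TopologicalSpace Y]
    {K : Set Y} (hK : IsCompact K) {F : Set (X × Y)} (hF : IsClosed F) :
    IsClosed {x | ∃ y ∈ K, (x, y) ∈ F} := by
  have : CompactSpace K := isCompact_iff_compactSpace.1 hK
  have h := isClosedMap_fst_of_compactSpace (X := X) (Y := K) _
    (hF.preimage (continuous_id.prodMap continuous_subtype_val))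
  convert h using 1
  ext x
  constructor
  · rintro ⟨y, hy, hxy⟩
    exact ⟨(x, ⟨y, hy⟩), hxy, rfl⟩
  · rintro ⟨⟨x', y⟩, hxy, rfl⟩
    exact ⟨y, y.2, hxy⟩

/-! ### Openness of contraction, irreducibility and non-similitude -/

section Openness

variable {d N : ℕ}

theorem norm_mulVec_le_sum_abs_mul (D : Matrix (Fin d) (Fin d) ℝ) (x : Fin d → ℝ) :
    ‖D.mulVec x‖ ≤ (∑ j, ∑ k, |D j k|) * ‖x‖ := by
  refine (pi_norm_le_iff_of_nonneg (by positivity)).2 fun j => ?_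
  calc ‖D.mulVec x j‖ ≤ ∑ k, ‖D j k * x k‖ :=
        norm_sum_le Finset.univ fun k => D j k * x k
    _ ≤ ∑ k, |D j k| * ‖x‖ := Finset.sum_le_sum fun k _ => by
        rw [norm_mul, Real.norm_eq_abs]
        exact mul_le_mul_of_nonneg_left (norm_le_pi_norm x k) (abs_nonneg _)
    _ = (∑ k, |D j k|) * ‖x‖ := by rw [Finset.sum_mul]
    _ ≤ _ := mul_le_mul_of_nonneg_right (Finset.single_le_sum (f := fun j => ∑ k, |D j k|)
        (fun _ _ => by positivity) (Finset.mem_univ j)) (norm_nonneg _)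

theorem continuous_coe_tuple (i : Fin N) :
    Continuous fun A : Fin N → GL (Fin d) ℝ => (A i : Matrix (Fin d) (Fin d) ℝ) :=
  Units.continuous_val.comp (continuous_apply i)

theorem isOpen_isContractingTuple : IsOpen {A : Fin N → GL (Fin d) ℝ | IsContractingTuple A} := by
  rw [isOpen_iff_mem_nhds]
  rintro A ⟨p, hp, hc⟩
  choose c hc1 hcp using hc
  obtain ⟨C, hC, hle⟩ := p.exists_norm_le_mul hp
  obtain ⟨C', hC', hle'⟩ := p.bound_of_continuous_normedSpace p.continuous_of_finiteDimensional
  -- A continuous bound, zero at A, for the operator norm of B_i - A_i with respect to p; the same p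
  -- then serves all nearby tuples.
  let h : Fin N → (Fin N → GL (Fin d) ℝ) → ℝ := fun i B =>
    C' * ((∑ j, ∑ k, |((B i : Matrix (Fin d) (Fin d) ℝ) - A i) j k|) * C)
  have hcont (i : Fin N) : Continuous (h i) := by
    refine continuous_const.mul (Continuous.mul (continuous_finsetSum _ fun j _ =>
      continuous_finsetSum _ fun k _ => ?_) continuous_const)
    exact (((continuous_coe_tuple i).sub continuous_const).matrix_elem j k).abs
  have hev : ∀ᶠ B in 𝓝 A, ∀ i, h i B < 1 - c i := by
    refine eventually_all.2 fun i => (hcont i).continuousAt.eventually_lt continuousAt_const ?_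
    simpa [h] using hc1 i
  filter_upwards [hev] with B hB
  refine ⟨p, hp, fun i => ⟨c i + h i B, by linarith [hB i], fun x => ?_⟩⟩
  have hsplit : (B i : Matrix (Fin d) (Fin d) ℝ).mulVec x =
      (A i : Matrix (Fin d) (Fin d) ℝ).mulVec x +
        ((B i : Matrix (Fin d) (Fin d) ℝ) - A i).mulVec x := by
    rw [← Matrix.add_mulVec, add_sub_cancel]
  rw [hsplit, add_mul]
  refine (map_add_le_add p _ _).trans (add_le_add (hcp i x) ((hle' _).trans ?_))
  simp only [h]
  rw [mul_assoc C', mul_assoc _ C]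
  exact mul_le_mul_of_nonneg_left ((norm_mulVec_le_sum_abs_mul _ x).trans
    (mul_le_mul_of_nonneg_left (hle x) (by positivity))) hC'.le

open Matrix in
/-- A tuple is reducible exactly when some nonzero vector has its whole orbit in a hyperplane. -/
theorem not_isIrreducibleTuple_iff (A : Fin N → GL (Fin d) ℝ) :
    ¬ IsIrreducibleTuple A ↔ ∃ y ∈ Metric.sphere (0 : Fin d → ℝ) 1 ×ˢ Metric.sphere 0 1,
      ∀ w : List (Fin N),
        y.2 ⬝ᵥ (w.map fun i => (A i : Matrix (Fin d) (Fin d) ℝ)).prod *ᵥ y.1 = 0 := by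
  constructor
  · intro h
    rw [IsIrreducibleTuple] at h
    push Not at h
    obtain ⟨U, hU, hbot, htop⟩ := h
    obtain ⟨u, huU, hu0⟩ := U.exists_mem_ne_zero_of_ne_bot hbot
    obtain ⟨f, hf0, hf⟩ := U.exists_le_ker_of_lt_top (lt_top_iff_ne_top.2 htop)
    obtain ⟨v, hv⟩ := (dotProductEquiv ℝ (Fin d)).surjective f
    have hv0 : v ≠ 0 := by
      rintro rfl
      exact hf0 (by rw [← hv, map_zero])
    have hword (w : List (Fin N)) :
        (w.map fun i => (A i : Matrix (Fin d) (Fin d) ℝ)).prod *ᵥ u ∈ U := by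
      induction w with
      | nil => simpa using huU
      | cons i w ih =>
        rw [List.map_cons, List.prod_cons, ← Matrix.mulVec_mulVec]
        exact hU i _ ih
    refine ⟨(‖u‖⁻¹ • u, ‖v‖⁻¹ • v), ⟨by simp [norm_smul, hu0], by simp [norm_smul, hv0]⟩,
      fun w => ?_⟩
    have h1 : v ⬝ᵥ (w.map fun i => (A i : Matrix (Fin d) (Fin d) ℝ)).prod *ᵥ u = 0 := by
      have := hf (hword w)
      rwa [← hv] at this
    simp only [Matrix.mulVec_smul, smul_dotProduct, dotProduct_smul, h1, smul_zero]
  · rintro ⟨⟨u, v⟩, ⟨hu, hv⟩, h⟩ hirr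
    rw [mem_sphere_zero_iff_norm] at hu hv
    -- The span of the orbit of u is invariant and nonzero, and lies in the hyperplane orthogonal to
    -- v, so it is proper.
    let U := Submodule.span ℝ (Set.range fun w : List (Fin N) =>
      (w.map fun i => (A i : Matrix (Fin d) (Fin d) ℝ)).prod *ᵥ u)
    have huU : u ∈ U := Submodule.subset_span ⟨[], by simp⟩
    have hle : U ≤ LinearMap.ker (dotProductEquiv ℝ (Fin d) v) := by
      refine Submodule.span_le.2 ?_
      rintro _ ⟨w, rfl⟩
      exact h w
    have hinv : ∀ i, U ≤ U.comap (A i : Matrix (Fin d) (Fin d) ℝ).mulVecLin := by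
      intro i
      refine Submodule.span_le.2 ?_
      rintro _ ⟨w, rfl⟩
      refine Submodule.subset_span ⟨i :: w, ?_⟩
      simp
    rcases hirr U fun i x hx => hinv i hx with hU | hU
    · rw [hU, Submodule.mem_bot] at huU
      have hu : ‖u‖ = 1 := hu
      simp [huU] at hu
    · have hvv : v ∈ LinearMap.ker (dotProductEquiv ℝ (Fin d) v) := hle (hU ▸ Submodule.mem_top)
      have hv0 : v = 0 := dotProduct_self_eq_zero.1 hvv
      have hv : ‖v‖ = 1 := hv
      simp [hv0] at hv

theorem isOpen_isIrreducibleTuple : IsOpen {A : Fin N → GL (Fin d) ℝ | IsIrreducibleTuple A} := by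
  rw [← isClosed_compl_iff]
  have hK : IsCompact (Metric.sphere (0 : Fin d → ℝ) 1 ×ˢ Metric.sphere (0 : Fin d → ℝ) 1) :=
    (isCompact_sphere _ _).prod (isCompact_sphere _ _)
  have hcont (w : List (Fin N)) : Continuous fun A : Fin N → GL (Fin d) ℝ =>
      (w.map fun i => (A i : Matrix (Fin d) (Fin d) ℝ)).prod :=
    continuous_list_prod w fun i _ => continuous_coe_tuple i
  have hF : IsClosed {z : (Fin N → GL (Fin d) ℝ) × (Fin d → ℝ) × (Fin d → ℝ) |
      ∀ w : List (Fin N), z.2.2 ⬝ᵥ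
        ((w.map fun i => (z.1 i : Matrix (Fin d) (Fin d) ℝ)).prod.mulVec z.2.1) = 0} := by
    rw [Set.ofPred_forall]
    refine isClosed_iInter fun w => isClosed_eq ?_ continuous_const
    exact continuous_snd.snd.dotProduct
      (((hcont w).comp continuous_fst).matrix_mulVec continuous_snd.fst)
  convert hK.isClosed_exists_mem hF using 1
  ext A
  exact not_isIrreducibleTuple_iff A

open Matrix in
/-- The symmetric positive semidefinite matrices of trace `1`. -/
def normalizedPosSemidef (d : ℕ) : Set (Matrix (Fin d) (Fin d) ℝ) :=
  {Q | Qᵀ = Q ∧ (∀ x, 0 ≤ x ⬝ᵥ Q *ᵥ x) ∧ Q.trace = 1}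

open Matrix in
theorem isCompact_normalizedPosSemidef : IsCompact (normalizedPosSemidef d) := by
  have hclosed : IsClosed (normalizedPosSemidef d) := by
    refine (isClosed_eq continuous_id.matrix_transpose continuous_id).inter (IsClosed.inter ?_
      (isClosed_eq continuous_id.matrix_trace continuous_const))
    have : {Q : Matrix (Fin d) (Fin d) ℝ | ∀ x, 0 ≤ x ⬝ᵥ Q *ᵥ x} =
        ⋂ x : Fin d → ℝ, {Q | 0 ≤ x ⬝ᵥ Q *ᵥ x} := Set.ofPred_forall _
    change IsClosed {Q : Matrix (Fin d) (Fin d) ℝ | ∀ x, 0 ≤ x ⬝ᵥ Q *ᵥ x}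
    rw [this]
    exact isClosed_iInter fun x => isClosed_le continuous_const
      (continuous_const.dotProduct (continuous_id.matrix_mulVec continuous_const))
  have hbox : IsCompact (Set.univ.pi fun _ : Fin d => Set.univ.pi fun _ : Fin d =>
      Set.Icc (-1 : ℝ) 1) :=
    isCompact_univ_pi fun _ => isCompact_univ_pi fun _ => isCompact_Icc
  refine hbox.of_isClosed_subset hclosed ?_
  have hentry (Q : Matrix (Fin d) (Fin d) ℝ) (hQ : Q ∈ normalizedPosSemidef d) (i j : Fin d) :
      Q i j ∈ Set.Icc (-1 : ℝ) 1 := by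
    obtain ⟨hsymm, hpos, htr⟩ := hQ
    -- The form at a e_i + b e_j; the choices (1, 1) and (1, -1) give 2|Q_ij| ≤ Q_ii + Q_jj ≤ 2.
    have hquad (a b : ℝ) : 0 ≤ a ^ 2 * Q i i + 2 * a * b * Q i j + b ^ 2 * Q j j := by
      have h := hpos (a • Pi.single i 1 + b • Pi.single j 1)
      have hji : Q j i = Q i j := congrFun (congrFun hsymm i) j
      simp only [Matrix.mulVec_add, Matrix.mulVec_smul, Matrix.mulVec_single_one, add_dotProduct,
        dotProduct_add, smul_dotProduct, dotProduct_smul, single_one_dotProduct, smul_eq_mul,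
        Matrix.col_apply, hji] at h
      linarith
    have hdiag (k : Fin d) : Q k k ≤ 1 := by
      rw [← htr]
      refine Finset.single_le_sum (f := fun k => Q k k) (fun l _ => ?_) (Finset.mem_univ k)
      simpa [Matrix.mulVec_single_one] using hpos (Pi.single l 1)
    have h1 := hquad 1 1
    have h2 := hquad 1 (-1)
    constructor <;> linarith [hdiag i, hdiag j]
  exact fun Q hQ i _ j _ => hentry Q hQ i j

open Matrix in
theorem exists_dotProduct_mulVec_eq_inner (c : InnerProductSpace.Core ℝ (Fin d → ℝ)) :
    ∃ Q : Matrix (Fin d) (Fin d) ℝ, ∀ x y, x ⬝ᵥ Q *ᵥ y = c.inner x y := by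
  have hsymm (x y : Fin d → ℝ) : c.inner x y = c.inner y x := (c.conj_inner_symm x y).symm
  have hsmul (r : ℝ) (x y : Fin d → ℝ) : c.inner (r • x) y = r * c.inner x y := c.smul_left x y r
  let B : (Fin d → ℝ) →ₗ[ℝ] (Fin d → ℝ) →ₗ[ℝ] ℝ := LinearMap.mk₂ ℝ c.inner c.add_left hsmul
    (fun x y z => by rw [hsymm, c.add_left, hsymm y, hsymm z])
    (fun r x y => by rw [hsymm, hsmul, hsymm y, smul_eq_mul])
  refine ⟨LinearMap.toMatrix₂' ℝ B, fun x y => ?_⟩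
  rw [← Matrix.toLinearMap₂'_apply', Matrix.toLinearMap₂'_toMatrix']
  rfl

open Matrix in
/-- An irreducible tuple consists of similitudes for some inner product exactly when it scales
some nonzero positive semidefinite quadratic form. -/
theorem IsIrreducibleTuple.areSimultaneouslySimilitudes_iff {A : Fin N → GL (Fin d) ℝ}
    (hA : IsIrreducibleTuple A) (hd : 0 < d) :
    AreSimultaneouslySimilitudes A ↔ ∃ Q ∈ normalizedPosSemidef d, ∀ i x,
      ((A i).1 *ᵥ x) ⬝ᵥ Q *ᵥ ((A i).1 *ᵥ x) =
        (∑ k, ((A i).1 *ᵥ Pi.single k 1) ⬝ᵥ Q *ᵥ ((A i).1 *ᵥ Pi.single k 1)) *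
          (x ⬝ᵥ Q *ᵥ x) := by
  -- As Q has trace 1, summing over the standard basis forces the scaling factor to be the trace of
  -- A_iᵀ Q A_i. It is thus continuous in the data rather than a further unknown.
  have htrace (Q : Matrix (Fin d) (Fin d) ℝ) :
      Q.trace = ∑ k, Pi.single k 1 ⬝ᵥ Q *ᵥ Pi.single k 1 := by
    simp [Matrix.trace]
  constructor
  · rintro ⟨c, hc⟩
    obtain ⟨Q, hQ⟩ := exists_dotProduct_mulVec_eq_inner c
    have hnonneg (x) : 0 ≤ c.inner x x := c.re_inner_nonneg x
    have htr : 0 < Q.trace := by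
      rw [htrace]
      refine Finset.sum_pos (fun k _ => ?_) ⟨⟨0, hd⟩, Finset.mem_univ _⟩
      rw [hQ]
      refine lt_of_le_of_ne (hnonneg _) fun h => ?_
      have := congrFun (c.definite _ h.symm) k
      simp at this
    have hquad (x y) : x ⬝ᵥ (Q.trace⁻¹ • Q) *ᵥ y = Q.trace⁻¹ * c.inner x y := by
      rw [Matrix.smul_mulVec, dotProduct_smul, hQ, smul_eq_mul]
    refine ⟨Q.trace⁻¹ • Q, ⟨?_, fun x => ?_, ?_⟩, fun i x => ?_⟩
    · rw [Matrix.transpose_smul]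
      congr 1
      ext i j
      have h := c.conj_inner_symm (Pi.single i 1) (Pi.single j 1)
      rw [← hQ, ← hQ] at h
      simpa [Matrix.mulVec_single_one] using h
    · rw [hquad]
      exact mul_nonneg (inv_nonneg.2 htr.le) (hnonneg x)
    · rw [Matrix.trace_smul, smul_eq_mul, inv_mul_cancel₀ htr.ne']
    · obtain ⟨r, hr, h⟩ := hc i
      have hsum : ∑ k, (Pi.single k 1 : Fin d → ℝ) ⬝ᵥ (Q.trace⁻¹ • Q) *ᵥ Pi.single k 1 = 1 := by
        rw [← htrace, Matrix.trace_smul, smul_eq_mul, inv_mul_cancel₀ htr.ne']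
      simp only [hquad] at hsum
      simp only [hquad, h, mul_left_comm _ (r ^ 2)]
      rw [← Finset.mul_sum, hsum, mul_one]
  · rintro ⟨Q, ⟨hsymm, hpos, htr⟩, h⟩
    have hsemi : Q.PosSemidef := Matrix.PosSemidef.of_dotProduct_mulVec_nonneg
      (by rw [Matrix.IsHermitian, Matrix.conjTranspose_eq_transpose_of_trivial, hsymm]) hpos
    have hzero (x : Fin d → ℝ) : x ⬝ᵥ Q *ᵥ x = 0 ↔ Q *ᵥ x = 0 := hsemi.dotProduct_mulVec_zero_iff x
    -- For semidefinite Q the kernel is the set of isotropic vectors, which the scaling relation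
    -- makes invariant; it is not everything because the trace is 1.
    have hker : LinearMap.ker Q.mulVecLin = ⊥ := by
      refine (hA _ fun i u hu => ?_).resolve_right fun htop => ?_
      · rw [LinearMap.mem_ker, Matrix.mulVecLin_apply, ← hzero] at hu ⊢
        rw [h, hu, mul_zero]
      · have hQ0 : Q = 0 := by
          ext i j
          have : Pi.single j 1 ∈ LinearMap.ker Q.mulVecLin := htop ▸ Submodule.mem_top
          rw [LinearMap.mem_ker, Matrix.mulVecLin_apply, Matrix.mulVec_single_one] at this
          exact congrFun this i
        rw [hQ0, Matrix.trace_zero] at htr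
        exact zero_ne_one htr
    have hdef (x : Fin d → ℝ) (hx : x ⬝ᵥ Q *ᵥ x = 0) : x = 0 := by
      have : x ∈ LinearMap.ker Q.mulVecLin := (hzero x).1 hx
      rwa [hker, Submodule.mem_bot] at this
    let c : InnerProductSpace.Core ℝ (Fin d → ℝ) :=
      { inner := fun x y => x ⬝ᵥ Q *ᵥ y
        conj_inner_symm := fun x y => by
          rw [conj_trivial, Matrix.dotProduct_mulVec, ← Matrix.mulVec_transpose, hsymm,
            dotProduct_comm]
        re_inner_nonneg := hpos
        add_left := fun x y z => add_dotProduct _ _ _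
        smul_left := fun x y r => smul_dotProduct _ _ _
        definite := hdef }
    refine ⟨c, fun i => ?_⟩
    set ρ := ∑ k, ((A i).1 *ᵥ Pi.single k 1) ⬝ᵥ Q *ᵥ ((A i).1 *ᵥ Pi.single k 1)
    have hρ : 0 < ρ := by
      refine Finset.sum_pos (fun k _ => ?_) ⟨⟨0, hd⟩, Finset.mem_univ _⟩
      refine lt_of_le_of_ne (hpos _) fun h0 => ?_
      have h1 := congrArg (fun v => ((A i)⁻¹).1 *ᵥ v) (hdef _ h0.symm)
      simp only [Matrix.mulVec_mulVec, Matrix.mulVec_zero, ← Units.val_mul, inv_mul_cancel,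
        Units.val_one, Matrix.one_mulVec] at h1
      have := congrFun h1 k
      simp at this
    refine ⟨√ρ, Real.sqrt_pos.2 hρ, fun x => ?_⟩
    rw [Real.sq_sqrt hρ.le]
    exact h i x

open Matrix in
theorem isOpen_isIrreducibleTuple_and_not_areSimultaneouslySimilitudes (hd : 0 < d) :
    IsOpen {A : Fin N → GL (Fin d) ℝ |
      IsIrreducibleTuple A ∧ ¬ AreSimultaneouslySimilitudes A} := by
  have hquad {X : Type} [TopologicalSpace X] {M : X → Matrix (Fin d) (Fin d) ℝ}
      {v : X → Fin d → ℝ} (hM : Continuous M) (hv : Continuous v) :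
      Continuous fun x => v x ⬝ᵥ M x *ᵥ v x :=
    hv.dotProduct (hM.matrix_mulVec hv)
  have hF : IsClosed {z : (Fin N → GL (Fin d) ℝ) × Matrix (Fin d) (Fin d) ℝ | ∀ i x,
      ((z.1 i).1 *ᵥ x) ⬝ᵥ z.2 *ᵥ ((z.1 i).1 *ᵥ x) =
        (∑ k, ((z.1 i).1 *ᵥ Pi.single k 1) ⬝ᵥ z.2 *ᵥ ((z.1 i).1 *ᵥ Pi.single k 1)) *
          (x ⬝ᵥ z.2 *ᵥ x)} := by
    simp only [Set.ofPred_forall]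
    refine isClosed_iInter fun i => isClosed_iInter fun x => ?_
    have hv (y : Fin d → ℝ) : Continuous fun z : (Fin N → GL (Fin d) ℝ) ×
        Matrix (Fin d) (Fin d) ℝ => (z.1 i).1 *ᵥ y :=
      ((continuous_coe_tuple i).comp continuous_fst).matrix_mulVec continuous_const
    exact isClosed_eq (hquad continuous_snd (hv x))
      ((continuous_finsetSum _ fun k _ => hquad continuous_snd (hv _)).mul
        (hquad continuous_snd continuous_const))
  have hclosed := isCompact_normalizedPosSemidef.isClosed_exists_mem hF
  convert isOpen_isIrreducibleTuple.inter hclosed.isOpen_compl using 1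
  ext A
  exact and_congr_right fun hA => not_congr (hA.areSimultaneouslySimilitudes_iff hd)

end Openness

/-! ### Assembly -/

theorem mainTheorem6 (d N : ℕ) (hN : 2 ≤ N) :
    IsOpen {A : Fin N → GL (Fin d) ℝ |
      IsContractingTuple A ∧
      (0 < affinityDimension A ∧ affinityDimension A < d) ∧
      IsIrreducibleTuple A ∧
      ¬ AreSimultaneouslySimilitudes A} := by
  rcases Nat.eq_zero_or_pos d with rfl | hd
  · convert isOpen_empty using 1
    refine Set.eq_empty_of_forall_notMem ?_
    rintro A ⟨-, ⟨h0, h1⟩, -⟩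
    rw [Nat.cast_zero] at h1
    exact lt_asymm h0 h1
  have hdet : IsOpen {A : Fin N → GL (Fin d) ℝ |
      ∑ i, |(A i : Matrix (Fin d) (Fin d) ℝ).det| < 1} :=
    isOpen_lt (continuous_finsetSum _ fun i _ => (continuous_coe_tuple i).matrix_det.abs)
      continuous_const
  -- The determinant criterion replaces (ii) only for contracting tuples, which suffices inside the
  -- intersection.
  convert isOpen_isContractingTuple.inter (hdet.inter
    (isOpen_isIrreducibleTuple_and_not_areSimultaneouslySimilitudes hd)) using 1
  ext A
  exact and_congr_right fun hA => and_congr_left' (hA.affinityDimension_mem_Ioo_iff hN hd)
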